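/- For every integer $k\ge 1$ let $n_k,m_k\ge 2$ be integers and let $\mathcal D_k\subseteq\{0,\dots,n_k-1\}\times\{0,\dots,m_k-1\}$ with $\operatorname{card}\mathcal D_k\ge 2$. For $w\in\mathcal D_k$ put $\Phi_w(x)=\operatorname{diag}(n_k^{-1},m_k^{-1})(x+w)$, $x\in\mathbb R^2$, and let $$E=\bigcap_{k=1}^\infty\ \bigcup_{w_1\cdots w_k\in\prod_{j=1}^k\mathcal D_j}\Phi_{w_1}\circ\cdots\circ\Phi_{w_k}([0,1]^2)$$ be the associated self-affine Moran set. Let $\Sigma^\infty=\prod_{k\ge1}\mathcal D_k$ and let $\Pi:\Sigma^\infty\to\mathbb R^2$, $$\Pi(w_1w_2\cdots)=\sum_{k=1}^\infty\operatorname{diag}\Big(\prod_{h=1}^k n_h^{-1},\prod_{h=1}^k m_h^{-1}\Big)w_k .$$ Let $\mathcal P$ be the set of sequences $\mathbf p=(\mathbf p_k)_{k\ge1}$ where $\mathbf p_k=(p_k(w))_{w\in\mathcal D_k}$ is a probability vector on $\mathcal D_k$. For $\mathbf p\in\mathcal P$ let $\nu_{\mathbf p}$ be the product probability measure on $\Sigma^\infty$,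 which gives the cylinder of $w_1\cdots w_k$ mass $p_1(w_1)\cdots p_k(w_k)$, and let $\mu_{\mathbf p}=\nu_{\mathbf p}\circ\Pi^{-1}$ be the corresponding self-affine Moran measure on $E$. For a finite Borel measure $\mu$ on $\mathbb R^2$ write $$\dim_{\mathrm H}\mu=\inf\{\dim_{\mathrm H}A:\mu(A^c)=0\},\qquad \dim_{\mathrm P}\mu=\inf\{\dim_{\mathrm P}A:\mu(A^c)=0\},$$ where $\dim_{\mathrm H}A$ and $\dim_{\mathrm P}A$ are the Hausdorff and packing dimensions of the set $A$. Suppose that: - $\sup\{n_k,m_k:k\ge1\}<\infty$; - $E$ satisfies the frequency separation condition: calling $\mathcal D_k$ centred if $i\notin\{0,n_k-1\}$ and $j\notin\{0,m_k-1\}$ for every $(i,j)\in\mathcal D_k$, there is $c>0$ with $$\lim_{n\to\infty}\frac{\operatorname{card}\{1\le k\le n:\mathcal D_k\text{ is centred}\}}{n}=c;$$ - $n_k\ge m_k$ for all $k\ge1$; - for each $k\ge1$ there is an integer $c_k$ such that $r_k(j):=\operatorname{card}\{i:(i,j)\in\mathcal D_k\}$ equals $c_k$ for every $j$ with $r_k(j)\ne0$.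 Then there exists a single $\mathbf p\in\mathcal P$ such that $$\dim_{\mathrm H}\mu_{\mathbf p}=\max\{\dim_{\mathrm H}\mu_{\mathbf p'}:\mathbf p'\in\mathcal P\}=\dim_{\mathrm H}E,$$ $$\dim_{\mathrm P}\mu_{\mathbf p}=\max\{\dim_{\mathrm P}\mu_{\mathbf p'}:\mathbf p'\in\mathcal P\}=\dim_{\mathrm P}E .$$ -/

import Mathlib

open MeasureTheory Filter Topology Set
open scoped ENNReal NNReal

noncomputable section

/-- The Euclidean plane. -/
abbrev Plane : Type := EuclideanSpace ℝ (Fin 2)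

/-! ## Packing measure, packing dimension, dimensions of measures -/

section Packing

variable {X : Type*} [MetricSpace X]

/-- `P` is a `δ`-packing of `A`: a countable set of (centre, radius) pairs whose centres lie in
`A`, whose radii lie in `(0, δ]`, and whose closed balls are pairwise disjoint. -/
def IsBallPacking (δ : ℝ) (A : Set X) (P : Set (X × ℝ)) : Prop :=
  P.Countable ∧ (∀ b ∈ P, b.1 ∈ A ∧ 0 < b.2 ∧ b.2 ≤ δ) ∧
    P.PairwiseDisjoint (fun b => Metric.closedBall b.1 b.2)

/-- `P^s_δ(A) = sup ∑ (2 r_i)^s`, over all `δ`-packings `{B(x_i, r_i)}` of `A`. -/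
def packingContent (s δ : ℝ) (A : Set X) : ℝ≥0∞ :=
  ⨆ (P : Set (X × ℝ)) (_ : IsBallPacking δ A P), ∑' b : P, ENNReal.ofReal ((2 * b.1.2) ^ s)

/-- The `s`-dimensional packing premeasure: the limit (infimum) of `P^s_δ(A)` as `δ → 0`. -/
def packingPremeasure (s : ℝ) (A : Set X) : ℝ≥0∞ :=
  ⨅ (δ : ℝ) (_ : 0 < δ), packingContent s δ A

/-- The `s`-dimensional packing measure: the infimum of `∑ P^s_0(A_i)` over all countable covers
`A ⊆ ⋃ A_i`. -/
def packingMeasure (s : ℝ) (A : Set X) : ℝ≥0∞ :=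
  ⨅ (C : ℕ → Set X) (_ : A ⊆ ⋃ i, C i), ∑' i, packingPremeasure s (C i)

/-- Packing dimension: the infimum of the `s ≥ 0` for which the `s`-dimensional packing measure
vanishes. -/
def dimP (A : Set X) : ℝ≥0∞ :=
  ⨅ (s : ℝ≥0) (_ : packingMeasure (s : ℝ) A = 0), (s : ℝ≥0∞)

/-- Hausdorff dimension of a Borel measure, `inf {dimH A : μ(Aᶜ) = 0}`. (Every null set is contained
in a Borel null set and `dimH` is monotone, so restricting to Borel sets `A` gives the same
number.) -/
def measureDimH [MeasurableSpace X] (μ : Measure X) : ℝ≥0∞ :=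
  ⨅ (A : Set X) (_ : μ Aᶜ = 0), dimH A

/-- Packing dimension of a Borel measure, `inf {dimP A : μ(Aᶜ) = 0}`. -/
def measureDimP [MeasurableSpace X] (μ : Measure X) : ℝ≥0∞ :=
  ⨅ (A : Set X) (_ : μ Aᶜ = 0), dimP A

end Packing

/-! ## Self-affine Moran constructions -/

/-- A construction `{(n_k, m_k, D_k)}`: integers `n_k, m_k ≥ 2` and digit sets
`D_k ⊆ {0, …, n_k - 1} × {0, …, m_k - 1}` with at least two elements. The levels are numbered from
`0`, so that index `k` stands for level `k + 1` of the usual numbering. -/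
structure MoranConstruction where
  n : ℕ → ℕ
  m : ℕ → ℕ
  D : ℕ → Finset (ℕ × ℕ)
  two_le_n : ∀ k, 2 ≤ n k
  two_le_m : ∀ k, 2 ≤ m k
  digit_lt : ∀ k, ∀ w ∈ D k, w.1 < n k ∧ w.2 < m k
  two_le_card : ∀ k, 2 ≤ (D k).card

namespace MoranConstruction

variable (M : MoranConstruction)

/-- Words of length `k`: one digit from each of the first `k` digit sets. -/
abbrev Word (k : ℕ) : Type := (i : Fin k) → {w : ℕ × ℕ // w ∈ M.D i}

/-- Infinite words: one digit from each digit set. It carries the product `σ`-algebra, which is the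
Borel `σ`-algebra of the product of the discrete spaces `D_k`. -/
abbrev InfWord : Type := (k : ℕ) → {w : ℕ × ℕ // w ∈ M.D k}

/-- The affine map `x ↦ T_k (x + w)`, where `T_k = diag(1/n_k, 1/m_k)`. -/
def digitMap (k : ℕ) (w : ℕ × ℕ) (x : Plane) : Plane :=
  !₂[(M.n k : ℝ)⁻¹ * (x 0 + w.1), (M.m k : ℝ)⁻¹ * (x 1 + w.2)]

/-- The composition `Φ_{w_1} ∘ ⋯ ∘ Φ_{w_k}` along a word of length `k`. -/
def wordMap : (k : ℕ) → M.Word k → Plane → Plane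
  | 0, _ => id
  | k + 1, w => wordMap k (fun i => w i.castSucc) ∘ M.digitMap k (w (Fin.last k))

/-- The unit square `[0,1]²`. -/
def unitSquare : Set Plane := {x | ∀ i, x i ∈ Set.Icc (0 : ℝ) 1}

/-- The self-affine Moran set `E = ⋂_{k ≥ 1} ⋃_{w of length k} Φ_w([0,1]²)`. -/
def moranSet : Set Plane :=
  ⋂ (k : ℕ) (_ : 1 ≤ k), ⋃ w : M.Word k, M.wordMap k w '' unitSquare

/-- The coding map
`Π(w) = ∑_k diag((n_1 ⋯ n_k)⁻¹, (m_1 ⋯ m_k)⁻¹) w_k`. -/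
def coding (w : M.InfWord) : Plane :=
  !₂[∑' k, (∏ h ∈ Finset.range (k + 1), (M.n h : ℝ))⁻¹ * ((w k).1.1 : ℝ),
    ∑' k, (∏ h ∈ Finset.range (k + 1), (M.m h : ℝ))⁻¹ * ((w k).1.2 : ℝ)]

/-- The coding map is measurable, so that image measures under it are meaningful. -/
theorem measurable_coding : Measurable M.coding := by
  have hk : ∀ k : ℕ, Measurable fun w : M.InfWord => (w k).1 := fun k =>
    measurable_subtype_coe.comp (measurable_pi_apply k)
  have hcast : Measurable (fun i : ℕ => (i : ℝ)) := measurable_from_nat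
  have h : Measurable fun w : M.InfWord =>
      (![∑' k, (∏ h ∈ Finset.range (k + 1), (M.n h : ℝ))⁻¹ * ((w k).1.1 : ℝ),
        ∑' k, (∏ h ∈ Finset.range (k + 1), (M.m h : ℝ))⁻¹ * ((w k).1.2 : ℝ)] : Fin 2 → ℝ) := by
    refine measurable_pi_lambda _ fun a => ?_
    fin_cases a
    · exact Measurable.tsum fun k => (hcast.comp (measurable_fst.comp (hk k))).const_mul _
    · exact Measurable.tsum fun k => (hcast.comp (measurable_snd.comp (hk k))).const_mul _
  exact (WithLp.measurable_toLp 2 (Fin 2 → ℝ)).comp h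

/-- Sequences `p = (p_k)` of probability vectors `p_k` on the digit sets `D_k`. -/
abbrev ProbSeq : Type := (k : ℕ) → PMF {w : ℕ × ℕ // w ∈ M.D k}

/-- The product measure `ν_p` on infinite words, which gives the cylinder of `w_1 ⋯ w_k` the mass
`p_1(w_1) ⋯ p_k(w_k)`. -/
def codeMeasure (p : M.ProbSeq) : Measure M.InfWord :=
  Measure.infinitePi fun k => (p k).toMeasure

/-- The self-affine Moran measure `μ_p(A) = ν_p(Π⁻¹ A)`. -/
def moranMeasure (p : M.ProbSeq) : Measure Plane :=
  (M.codeMeasure p).map M.coding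

/-- `D_k` is centred: no digit `(i, j)` has `i ∈ {0, n_k - 1}` or `j ∈ {0, m_k - 1}`. -/
def IsCentred (k : ℕ) : Prop :=
  ∀ w ∈ M.D k, (w.1 ≠ 0 ∧ w.1 ≠ M.n k - 1) ∧ (w.2 ≠ 0 ∧ w.2 ≠ M.m k - 1)

/-- The frequency separation condition: the levels with a centred digit set have a positive
asymptotic frequency. -/
def FrequencySeparation : Prop :=
  ∃ c : ℝ, 0 < c ∧
    Tendsto (fun N : ℕ => ({k | k < N ∧ M.IsCentred k}.ncard : ℝ) / N) atTop (𝓝 c)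

/-- `r_k(j) = card {i : (i, j) ∈ D_k}`. -/
def rowCount (k j : ℕ) : ℕ := {i | (i, j) ∈ M.D k}.ncard

end MoranConstruction

end

noncomputable section

/-! ## Dimensions of a set carrying an equidistributed measure -/

section ScaleSequence

variable {ρ : ℕ → ℝ}

/-! The witness is the sequence of uniform probability vectors, for both dimensions at once. Every
`μ_p` is carried by `E`, so its dimensions never exceed those of `E`; only the lower bounds for the
uniform measure need work.

At vertical level `k`, choose `l ≤ k` with `n_1⋯n_l` comparable to `m_1⋯m_k`
(`exists_comparable_level`). The grid rectangles fixed by `l` horizontal and `k` vertical digits are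
then approximate squares of size `ρ ≈ (m_1⋯m_k)⁻¹`. Since all nonempty rows of a digit set have
equal size, the uniform measure on words gives every such address the same mass
(`codeMeasure_gridIndex_fiber`), namely `1/N` if there are `N` addresses. A ball of radius `ρ` meets
at most 16 of the rectangles, so its mass is at most `16/N`, while the `N` rectangles cover `E`.

It remains to see that such equidistribution along a geometric-like sequence of scales forces `dim E
≤ dim μ`. Whether `N_k ρ_k ^ t` exceeds 1 eventually (Hausdorff) or infinitely often (packing)
controls covers and packings of `E` on one side and the mass of balls on the other. This is
`dimH_le_measureDimH_of_equidistributed` and `dimP_le_measureDimP_of_equidistributed`. -/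

theorem scale_le_geometric (hhalf : ∀ k, 2 * ρ (k + 1) ≤ ρ k) (k : ℕ) :
    ρ k ≤ ρ 0 * (1 / 2) ^ k := by
  induction k with
  | zero => simp
  | succ k ih => rw [pow_succ]; linarith [hhalf k]

theorem tendsto_scale (hpos : ∀ k, 0 < ρ k) (hhalf : ∀ k, 2 * ρ (k + 1) ≤ ρ k) :
    Tendsto ρ atTop (𝓝 0) := by
  refine squeeze_zero (fun k => (hpos k).le) (scale_le_geometric hhalf) ?_
  simpa using (tendsto_pow_atTop_nhds_zero_of_lt_one (r := (1 / 2 : ℝ)) (by norm_num)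
    (by norm_num)).const_mul (ρ 0)

theorem exists_scale_bracket (hpos : ∀ k, 0 < ρ k) (hhalf : ∀ k, 2 * ρ (k + 1) ≤ ρ k)
    {k₀ : ℕ} {r : ℝ} (hr : 0 < r) (hr' : r ≤ ρ k₀) :
    ∃ k, ρ (k + k₀ + 1) < r ∧ r ≤ ρ (k + k₀) := by
  have hex : ∃ k, ρ (k + k₀) < r :=
    (((tendsto_scale hpos hhalf).comp (tendsto_add_atTop_nat k₀)).eventually_lt_const hr).exists
  classical
  have h0 : Nat.find hex ≠ 0 := by
    intro h
    have := Nat.find_spec hex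
    rw [h] at this
    simp only [zero_add] at this
    linarith
  obtain ⟨j, hj⟩ := Nat.exists_eq_succ_of_ne_zero h0
  refine ⟨j, ?_, ?_⟩
  · have := Nat.find_spec hex
    rw [hj] at this
    convert this using 2
    omega
  · have := Nat.find_min hex (m := j) (by omega)
    linarith

theorem tendsto_scale_rpow (hpos : ∀ k, 0 < ρ k) (hhalf : ∀ k, 2 * ρ (k + 1) ≤ ρ k)
    {t : ℝ} (ht : 0 < t) (c : ℝ) :
    Tendsto (fun k => ENNReal.ofReal (c * ρ k ^ t)) atTop (𝓝 0) := by
  have h := ((tendsto_scale hpos hhalf).rpow_const (Or.inr ht.le)).const_mul c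
  rw [Real.zero_rpow ht.ne', mul_zero] at h
  simpa using ENNReal.tendsto_ofReal h

end ScaleSequence

section Equidistributed

variable {X : Type*} [MetricSpace X] {ι : Type*} {E : Set X}
  {ρ : ℕ → ℝ} {T : ℕ → Finset ι} {f : ℕ → ι → Set X} {K B : ℝ}

theorem hausdorffMeasure_ne_top_of_frequently_card_le [MeasurableSpace X] [BorelSpace X]
    (hpos : ∀ k, 0 < ρ k) (hhalf : ∀ k, 2 * ρ (k + 1) ≤ ρ k) (hK : 0 < K)
    (hcover : ∀ k, E ⊆ ⋃ i ∈ T k, f k i)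
    (hdiam : ∀ k, ∀ i ∈ T k, ∀ x ∈ f k i, ∀ y ∈ f k i, dist x y ≤ K * ρ k)
    {t : ℝ} (ht : 0 < t) (hfreq : ∃ᶠ k in atTop, ((T k).card : ℝ) * ρ k ^ t ≤ 1) :
    Measure.hausdorffMeasure t E ≠ ∞ := by
  have hd : ∀ k, ∀ i : T k, Metric.ediam (f k i) ≤ ENNReal.ofReal (K * ρ k) := fun k i =>
    Metric.ediam_le fun x hx y hy => by
      rw [edist_dist]
      exact ENNReal.ofReal_le_ofReal (hdiam k i i.2 x hx y hy)
  have h := Measure.hausdorffMeasure_le_liminf_sum t E (l := atTop)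
    (fun k => ENNReal.ofReal (K * ρ k))
    (by simpa using ENNReal.tendsto_ofReal ((tendsto_scale hpos hhalf).const_mul K))
    (fun k (i : T k) => f k i) (Eventually.of_forall hd)
    (Eventually.of_forall fun k x hx => by
      obtain ⟨i, hi, hxi⟩ := mem_iUnion₂.1 (hcover k hx)
      exact mem_iUnion.2 ⟨⟨i, hi⟩, hxi⟩)
  refine ne_top_of_le_ne_top (b := ENNReal.ofReal (K ^ t)) ENNReal.ofReal_ne_top (h.trans ?_)
  refine liminf_le_of_frequently_le (hfreq.mono fun k hk => ?_)
  calc ∑ i : T k, Metric.ediam (f k i) ^ t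
      ≤ ∑ _i : T k, ENNReal.ofReal (K * ρ k) ^ t :=
        Finset.sum_le_sum fun i _ => ENNReal.rpow_le_rpow (hd k i) ht.le
    _ = ENNReal.ofReal (K ^ t * (((T k).card : ℝ) * ρ k ^ t)) := by
        have hp := hpos k
        rw [Finset.sum_const, ENNReal.ofReal_rpow_of_pos (by positivity), nsmul_eq_mul,
          Finset.card_univ, Fintype.card_coe, ← ENNReal.ofReal_natCast,
          ← ENNReal.ofReal_mul (by positivity), Real.mul_rpow hK.le hp.le]
        ring_nf
    _ ≤ ENNReal.ofReal (K ^ t) := ENNReal.ofReal_le_ofReal <| by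
        have : 0 ≤ K ^ t := by positivity
        nlinarith

/-- Mass distribution principle along a sequence of scales. -/
theorem measure_le_hausdorffMeasure_of_forall_closedBall_le [MeasurableSpace X] [BorelSpace X]
    (μ : Measure X) (hpos : ∀ k, 0 < ρ k) (hhalf : ∀ k, 2 * ρ (k + 1) ≤ ρ k)
    (hB : ∀ k, ρ k ≤ B * ρ (k + 1)) (hK : 0 < K) (hB0 : 0 < B) {t : ℝ} (ht : 0 < t)
    (hmass : ∀ᶠ k in atTop, ∀ x, μ (Metric.closedBall x (ρ k)) ≤ ENNReal.ofReal (K * ρ k ^ t)) :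
    ENNReal.ofReal ((K * B ^ t)⁻¹) • μ ≤ Measure.hausdorffMeasure t := by
  obtain ⟨k₀, hk₀⟩ := eventually_atTop.1 hmass
  have hball : ∀ x r, 0 < r → r ≤ ρ k₀ →
      μ (Metric.closedBall x r) ≤ ENNReal.ofReal (K * B ^ t * r ^ t) := by
    intro x r hr hr'
    obtain ⟨k, hk1, hk2⟩ := exists_scale_bracket hpos hhalf hr hr'
    refine (measure_mono (Metric.closedBall_subset_closedBall hk2)).trans
      ((hk₀ _ (by omega) x).trans (ENNReal.ofReal_le_ofReal ?_))
    rw [mul_assoc, ← Real.mul_rpow hB0.le hr.le]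
    have := hpos (k + k₀)
    gcongr
    exact (hB _).trans (by gcongr)
  refine Measure.le_hausdorffMeasure t _ (ENNReal.ofReal (ρ k₀ / 2))
    (by simpa using hpos k₀) fun S hS => ?_
  rcases S.eq_empty_or_nonempty with rfl | ⟨x, hx⟩
  · simp
  have hfin : Metric.ediam S ≠ ∞ := ne_top_of_le_ne_top ENNReal.ofReal_ne_top hS
  have hd : Metric.diam S ≤ ρ k₀ / 2 := ENNReal.toReal_le_of_le_ofReal (by linarith [hpos k₀]) hS
  -- The ball bound needs a positive radius, but `S` may be a single point; so radii `r > diam S`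
  -- are used and then `r ↓ diam S`.
  have hlim : Tendsto (fun r => ENNReal.ofReal (K * B ^ t * r ^ t)) (𝓝[>] (Metric.diam S))
      (𝓝 (ENNReal.ofReal (K * B ^ t * Metric.diam S ^ t))) :=
    ENNReal.tendsto_ofReal (((Real.continuousAt_rpow_const _ _ (Or.inr ht.le)).tendsto.mono_left
      nhdsWithin_le_nhds).const_mul _)
  have hS' : μ S ≤ ENNReal.ofReal (K * B ^ t * Metric.diam S ^ t) := by
    refine ge_of_tendsto hlim ?_
    have : Metric.diam S < ρ k₀ := by linarith [hpos k₀]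
    filter_upwards [Ioo_mem_nhdsGT this] with r hr
    refine (measure_mono fun y hy => ?_).trans
      (hball x r (Metric.diam_nonneg.trans_lt hr.1) hr.2.le)
    exact (Metric.dist_le_diam_of_mem' hfin hy hx).trans hr.1.le
  calc (ENNReal.ofReal ((K * B ^ t)⁻¹) • μ) S
      = ENNReal.ofReal ((K * B ^ t)⁻¹) * μ S := by simp
    _ ≤ ENNReal.ofReal ((K * B ^ t)⁻¹) * ENNReal.ofReal (K * B ^ t * Metric.diam S ^ t) := by
        gcongr
    _ = ENNReal.ofReal (Metric.diam S ^ t) := by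
        rw [← ENNReal.ofReal_mul (by positivity), inv_mul_cancel_left₀ (by positivity)]
    _ = Metric.ediam S ^ t := by
        rw [← ENNReal.ofReal_rpow_of_nonneg Metric.diam_nonneg ht.le, Metric.diam,
          ENNReal.ofReal_toReal hfin]

/-- Suppose `dimH A < t < dimH E` with `A` of full measure. If `N_k ρ_k ^ t ≤ 1` infinitely often,
the natural covers keep the `t`-measure of `E` finite, which is impossible. Otherwise balls
eventually have mass at most `K ρ_k ^ t`, and mass distribution makes `A` a null set of `μ`. -/
theorem dimH_le_measureDimH_of_equidistributed [MeasurableSpace X] [BorelSpace X]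
    (μ : Measure X) [IsProbabilityMeasure μ]
    (hpos : ∀ k, 0 < ρ k) (hhalf : ∀ k, 2 * ρ (k + 1) ≤ ρ k) (hB : ∀ k, ρ k ≤ B * ρ (k + 1))
    (hK : 0 < K) (hB0 : 0 < B) (hcover : ∀ k, E ⊆ ⋃ i ∈ T k, f k i)
    (hdiam : ∀ k, ∀ i ∈ T k, ∀ x ∈ f k i, ∀ y ∈ f k i, dist x y ≤ K * ρ k)
    (hmass : ∀ k x, μ (Metric.closedBall x (ρ k)) ≤ ENNReal.ofReal (K / (T k).card)) :
    dimH E ≤ measureDimH μ := by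
  refine le_iInf₂ fun A hA => ?_
  by_contra! hlt
  obtain ⟨t, hAt, htE⟩ := ENNReal.lt_iff_exists_nnreal_btwn.1 hlt
  have ht : 0 < (t : ℝ) := by
    have : (0 : ℝ≥0∞) < t := bot_lt_iff_ne_bot.2 (ne_bot_of_gt hAt)
    exact_mod_cast this
  have hA0 := hausdorffMeasure_of_dimH_lt hAt
  have hET := hausdorffMeasure_of_lt_dimH htE
  have hev : ∀ᶠ k in atTop, 1 < ((T k).card : ℝ) * ρ k ^ (t : ℝ) := by
    by_contra hcon
    refine hausdorffMeasure_ne_top_of_frequently_card_le hpos hhalf hK hcover hdiam ht ?_ hET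
    exact (not_eventually.1 hcon).mono fun k hk => not_lt.1 hk
  have hle := measure_le_hausdorffMeasure_of_forall_closedBall_le μ hpos hhalf hB hK hB0 ht
    (hev.mono fun k hk x => (hmass k x).trans <| ENNReal.ofReal_le_ofReal <| by
      have hc : 0 < ((T k).card : ℝ) := by
        have := Real.rpow_pos_of_pos (hpos k) t
        by_contra! h
        nlinarith
      rw [div_le_iff₀ hc]
      nlinarith)
  have hμA : ENNReal.ofReal ((K * B ^ (t : ℝ))⁻¹) * μ A ≤ 0 := by
    simpa [hA0] using hle A
  have hμA0 : μ A = 0 := by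
    rcases mul_eq_zero.1 (nonpos_iff_eq_zero.1 hμA) with h | h
    · rw [ENNReal.ofReal_eq_zero] at h
      have : 0 < (K * B ^ (t : ℝ))⁻¹ := by positivity
      linarith
    · exact h
  have huniv : μ univ ≤ μ A + μ Aᶜ := by
    rw [← union_compl_self A]; exact measure_union_le _ _
  simp [hμA0, hA] at huniv

/-- Sort the balls of a packing by scale. A ball of radius above `K ρ_{k+1}` contains every piece of
level `k+1` through its centre, so disjoint balls of one class have centres in different pieces and
number at most `N_{k+1}`. Their contributions are dominated by a multiple of `∑ ρ_{k+1} ^ (t - s)`,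
a convergent series whose tails bound the packing contents. -/
theorem packingPremeasure_eq_zero_of_eventually_card_le
    (hpos : ∀ k, 0 < ρ k) (hhalf : ∀ k, 2 * ρ (k + 1) ≤ ρ k) (hB : ∀ k, ρ k ≤ B * ρ (k + 1))
    (hK : 0 < K) (hB0 : 0 < B) (hcover : ∀ k, E ⊆ ⋃ i ∈ T k, f k i)
    (hdiam : ∀ k, ∀ i ∈ T k, ∀ x ∈ f k i, ∀ y ∈ f k i, dist x y ≤ K * ρ k)
    {s t : ℝ} (hs : 0 ≤ s) (hst : s < t)
    (hev : ∀ᶠ k in atTop, ((T k).card : ℝ) * ρ k ^ s ≤ 1) :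
    packingPremeasure t E = 0 := by
  have ht : 0 < t := hs.trans_lt hst
  have hKpos : ∀ k, 0 < K * ρ k := fun k => mul_pos hK (hpos k)
  have hKhalf : ∀ k, 2 * (K * ρ (k + 1)) ≤ K * ρ k := fun k => by
    nlinarith [hhalf k]
  let g : ℕ → ℝ≥0∞ := fun k => ENNReal.ofReal ((2 * K * B) ^ t * ρ (k + 1) ^ (t - s))
  have hgsum : ∑' k, g k ≠ ∞ := by
    refine Summable.tsum_ofReal_ne_top (Summable.mul_left _ ?_)
    have hq : (1 / 2 : ℝ) ^ (t - s) < 1 :=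
      Real.rpow_lt_one (by norm_num) (by norm_num) (by linarith)
    refine Summable.of_nonneg_of_le (fun k => Real.rpow_nonneg (hpos _).le _) (fun k => ?_)
      (((summable_geometric_of_lt_one (by positivity) hq).comp_injective
        (add_left_injective 1)).mul_left (ρ 0 ^ (t - s)))
    have h0 := hpos 0
    calc ρ (k + 1) ^ (t - s) ≤ (ρ 0 * (1 / 2) ^ (k + 1)) ^ (t - s) :=
          Real.rpow_le_rpow (hpos _).le (scale_le_geometric hhalf _) (by linarith)
      _ = ρ 0 ^ (t - s) * (((1 / 2 : ℝ) ^ (t - s)) ^ (k + 1)) := by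
          rw [Real.mul_rpow h0.le (by positivity), ← Real.rpow_natCast, ← Real.rpow_natCast,
            ← Real.rpow_mul (by norm_num), ← Real.rpow_mul (by norm_num), mul_comm (t - s)]
  have htail := ENNReal.tendsto_sum_nat_add g hgsum
  obtain ⟨k₁, hk₁⟩ := eventually_atTop.1 hev
  refine nonpos_iff_eq_zero.1 (ge_of_tendsto htail ?_)
  filter_upwards [eventually_ge_atTop k₁] with k₀ hk₀
  refine (iInf₂_le (K * ρ k₀) (hKpos k₀)).trans (iSup₂_le fun P hP => ?_)
  have hκ : ∀ b : P, ∃ k, K * ρ (k + k₀ + 1) < b.1.2 ∧ b.1.2 ≤ K * ρ (k + k₀) := fun b =>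
    exists_scale_bracket hKpos hKhalf (hP.2.1 b b.2).2.1 (hP.2.1 b b.2).2.2
  choose κ hκ1 hκ2 using hκ
  have hi : ∀ b : P, ∃ i : T (κ b + k₀ + 1), b.1.1 ∈ f (κ b + k₀ + 1) i := fun b => by
    obtain ⟨i, hi, hx⟩ := mem_iUnion₂.1 (hcover (κ b + k₀ + 1) (hP.2.1 b b.2).1)
    exact ⟨⟨i, hi⟩, hx⟩
  choose i hi using hi
  let F : P → Σ k : ℕ, T (k + k₀ + 1) := fun b => ⟨κ b, i b⟩
  have hF : Function.Injective F := by
    -- Naming the common pair `(k, j)` separately allows each dependent equality to be eliminated on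
    -- its own.
    have key : ∀ (k : ℕ) (j : T (k + k₀ + 1)) (b c : P), F b = ⟨k, j⟩ → F c = ⟨k, j⟩ → b = c := by
      intro k j b c hb hc
      have hbm : b.1.1 ∈ f (k + k₀ + 1) j ∧ K * ρ (k + k₀ + 1) < b.1.2 := by
        have h1 := hi b
        have h2 := hκ1 b
        obtain ⟨rfl, hj⟩ := Sigma.mk.inj_iff.1 hb
        rw [← eq_of_heq hj]
        exact ⟨h1, h2⟩
      have hcm : c.1.1 ∈ f (k + k₀ + 1) j := by
        have h1 := hi c
        obtain ⟨rfl, hj⟩ := Sigma.mk.inj_iff.1 hc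
        rw [← eq_of_heq hj]
        exact h1
      by_contra hne
      have hdisj := hP.2.2 b.2 c.2 (fun h => hne (Subtype.ext h))
      have hmem : c.1.1 ∈ Metric.closedBall b.1.1 b.1.2 :=
        (hdiam _ _ j.2 _ hcm _ hbm.1).trans hbm.2.le
      exact Set.disjoint_left.1 hdisj hmem (Metric.mem_closedBall_self (hP.2.1 c c.2).2.1.le)
    intro b c hbc
    exact key _ _ b c rfl hbc.symm
  calc ∑' b : P, ENNReal.ofReal ((2 * b.1.2) ^ t)
      ≤ ∑' b : P, (fun x : Σ k : ℕ, T (k + k₀ + 1) =>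
          ENNReal.ofReal ((2 * (K * ρ (x.1 + k₀))) ^ t)) (F b) := by
        refine ENNReal.tsum_le_tsum fun b => ENNReal.ofReal_le_ofReal ?_
        have := (hP.2.1 b b.2).2.1
        exact Real.rpow_le_rpow (by positivity) (by linarith [hκ2 b]) ht.le
    _ ≤ ∑' x : Σ k : ℕ, T (k + k₀ + 1), ENNReal.ofReal ((2 * (K * ρ (x.1 + k₀))) ^ t) :=
        ENNReal.tsum_comp_le_tsum_of_injective hF _
    _ = ∑' k : ℕ, ((T (k + k₀ + 1)).card : ℝ≥0∞) *
          ENNReal.ofReal ((2 * (K * ρ (k + k₀))) ^ t) := by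
        rw [ENNReal.tsum_sigma']
        refine tsum_congr fun k => ?_
        simp only [tsum_fintype, Finset.sum_const, Finset.card_univ, Fintype.card_coe,
          nsmul_eq_mul]
    _ ≤ ∑' k, g (k + k₀) := by
        refine ENNReal.tsum_le_tsum fun k => ?_
        have hp := hpos (k + k₀)
        have hp' := hpos (k + k₀ + 1)
        rw [← ENNReal.ofReal_natCast, ← ENNReal.ofReal_mul (by positivity)]
        refine ENNReal.ofReal_le_ofReal ?_
        have hcard := hk₁ (k + k₀ + 1) (by omega)
        calc ((T (k + k₀ + 1)).card : ℝ) * (2 * (K * ρ (k + k₀))) ^ t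
            ≤ (T (k + k₀ + 1)).card * ((2 * K * B) * ρ (k + k₀ + 1)) ^ t := by
              gcongr ?_ * ?_ ^ t
              nlinarith [hB (k + k₀)]
          _ = (2 * K * B) ^ t * ρ (k + k₀ + 1) ^ (t - s) *
                ((T (k + k₀ + 1)).card * ρ (k + k₀ + 1) ^ s) := by
              rw [Real.mul_rpow (by positivity) hp'.le, Real.rpow_sub hp']
              have := Real.rpow_pos_of_pos hp' s
              field_simp
          _ ≤ (2 * K * B) ^ t * ρ (k + k₀ + 1) ^ (t - s) * 1 := by gcongr
          _ = _ := mul_one _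

/-- If some content of `C` were finite, a disjoint family of small balls centred in `C` whose
enlargements cover `C` would bound `μ C` by that content times a multiple of `ρ_k ^ (t - s)`, at
infinitely many scales. This tends to 0. -/
theorem packingPremeasure_eq_top_of_frequently_lt_card [SecondCountableTopology X]
    [MeasurableSpace X] (μ : Measure X)
    (hpos : ∀ k, 0 < ρ k) (hhalf : ∀ k, 2 * ρ (k + 1) ≤ ρ k) (hK : 0 < K)
    (hmass : ∀ k x, μ (Metric.closedBall x (ρ k)) ≤ ENNReal.ofReal (K / (T k).card))
    {s t : ℝ} (hst : s < t) (hfreq : ∃ᶠ k in atTop, 1 < ((T k).card : ℝ) * ρ k ^ t)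
    {C : Set X} (hC : μ C ≠ 0) : packingPremeasure s C = ∞ := by
  refine iInf₂_eq_top.2 fun δ hδ => ?_
  by_contra htop
  refine hC (nonpos_iff_eq_zero.1 ?_)
  have hlim : Tendsto (fun k => packingContent s δ C *
      ENNReal.ofReal (K * (5 / 2) ^ s * ρ k ^ (t - s))) atTop (𝓝 0) := by
    simpa using ENNReal.Tendsto.const_mul (tendsto_scale_rpow hpos hhalf (sub_pos.2 hst) _)
      (Or.inr htop)
  refine ge_of_tendsto_of_frequently hlim ?_
  have hδev : ∀ᶠ k in atTop, ρ k < δ :=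
    (tendsto_scale hpos hhalf).eventually_lt_const hδ
  refine (hfreq.and_eventually hδev).mono fun k ⟨hk, hkδ⟩ => ?_
  have hρ := hpos k
  -- With all radii equal to `ρ k / 5`, the enlarged balls have radius exactly `ρ k`, where `hmass`
  -- applies.
  obtain ⟨u, huC, hdisj, hcov⟩ := Vitali.exists_disjoint_subfamily_covering_enlargement_closedBall
    C id (fun _ => ρ k / 5) (ρ k / 5) (fun _ _ => le_rfl)
    5 (by norm_num)
  have hcount : u.Countable := hdisj.countable_of_nonempty_interior fun x _ =>
    ⟨x, mem_interior_iff_mem_nhds.2 (Metric.closedBall_mem_nhds x (by positivity))⟩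
  have hCu : C ⊆ ⋃ x ∈ u, Metric.closedBall x (ρ k) := fun a ha => by
    obtain ⟨b, hb, hab⟩ := hcov a ha
    refine mem_iUnion₂.2 ⟨b, hb, ?_⟩
    have := hab (Metric.mem_closedBall_self (by positivity))
    simpa [mul_div_cancel₀] using this
  have hcard : 0 < ((T k).card : ℝ) := by
    have := Real.rpow_pos_of_pos hρ t
    by_contra! h
    nlinarith
  have hpack : ∑' _x : u, ENNReal.ofReal ((2 * (ρ k / 5)) ^ s) ≤ packingContent s δ C := by
    let P : Set (X × ℝ) := (fun x => (x, ρ k / 5)) '' u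
    have hP : IsBallPacking δ C P := by
      refine ⟨hcount.image _, ?_, ?_⟩
      · rintro _ ⟨x, hx, rfl⟩
        exact ⟨huC hx, by positivity, by simp only; linarith⟩
      · rintro _ ⟨x, hx, rfl⟩ _ ⟨y, hy, rfl⟩ hxy
        exact hdisj hx hy fun h => hxy (by rw [h])
    refine le_trans (le_of_eq ?_) (le_iSup₂ (f := fun P (_ : IsBallPacking δ C P) =>
      ∑' b : P, ENNReal.ofReal ((2 * b.1.2) ^ s)) P hP)
    exact (tsum_image (g := fun x : X => (x, ρ k / 5))
      (fun b : X × ℝ => ENNReal.ofReal ((2 * b.2) ^ s))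
      (fun x _ y _ h => (Prod.mk.inj h).1)).symm
  calc μ C ≤ ∑' x : u, μ (Metric.closedBall (x : X) (ρ k)) :=
        (measure_mono hCu).trans (measure_biUnion_le _ hcount _)
    _ ≤ ∑' _x : u, ENNReal.ofReal ((2 * (ρ k / 5)) ^ s) *
          ENNReal.ofReal (K * (5 / 2) ^ s * ρ k ^ (t - s)) := by
        refine ENNReal.tsum_le_tsum fun x => (hmass k x).trans ?_
        rw [← ENNReal.ofReal_mul (by positivity)]
        refine ENNReal.ofReal_le_ofReal ?_
        have h1 : (2 * (ρ k / 5)) ^ s * (K * (5 / 2) ^ s * ρ k ^ (t - s)) = K * ρ k ^ t := by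
          have h2 : (2 * (ρ k / 5)) ^ s * (5 / 2) ^ s = ρ k ^ s := by
            rw [← Real.mul_rpow (by positivity) (by norm_num)]
            ring_nf
          have h3 : ρ k ^ s * ρ k ^ (t - s) = ρ k ^ t := by
            rw [← Real.rpow_add hρ]; ring_nf
          rw [← h3, ← h2]; ring
        rw [h1, div_le_iff₀ hcard]
        nlinarith
    _ = (∑' _x : u, ENNReal.ofReal ((2 * (ρ k / 5)) ^ s)) *
          ENNReal.ofReal (K * (5 / 2) ^ s * ρ k ^ (t - s)) := ENNReal.tsum_mul_right
    _ ≤ _ := by gcongr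

/-- Two intermediate exponents `s₀ < s < t` are needed: the gap up to `t` makes the series for `E`
converge, and the gap below `s` makes every set of positive mass have infinite `s₀`-premeasure. -/
theorem dimP_le_measureDimP_of_equidistributed [SecondCountableTopology X] [MeasurableSpace X]
    (μ : Measure X) [IsProbabilityMeasure μ]
    (hpos : ∀ k, 0 < ρ k) (hhalf : ∀ k, 2 * ρ (k + 1) ≤ ρ k) (hB : ∀ k, ρ k ≤ B * ρ (k + 1))
    (hK : 0 < K) (hB0 : 0 < B) (hcover : ∀ k, E ⊆ ⋃ i ∈ T k, f k i)
    (hdiam : ∀ k, ∀ i ∈ T k, ∀ x ∈ f k i, ∀ y ∈ f k i, dist x y ≤ K * ρ k)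
    (hmass : ∀ k x, μ (Metric.closedBall x (ρ k)) ≤ ENNReal.ofReal (K / (T k).card)) :
    dimP E ≤ measureDimP μ := by
  refine le_iInf₂ fun A hA => le_iInf₂ fun s₀ hs₀ => ?_
  by_contra! hlt
  obtain ⟨s, hs0s, hsE⟩ := ENNReal.lt_iff_exists_nnreal_btwn.1 hlt
  obtain ⟨t, hst, htE⟩ := ENNReal.lt_iff_exists_nnreal_btwn.1 hsE
  have hs : (s₀ : ℝ) < s := by exact_mod_cast hs0s
  have hfreq : ∃ᶠ k in atTop, 1 < ((T k).card : ℝ) * ρ k ^ (s : ℝ) := by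
    intro hcon
    have hE0 : packingPremeasure (t : ℝ) E = 0 :=
      packingPremeasure_eq_zero_of_eventually_card_le hpos hhalf hB hK hB0 hcover hdiam s.2
        (by exact_mod_cast hst) (hcon.mono fun k hk => not_lt.1 hk)
    refine htE.not_ge (iInf₂_le t (nonpos_iff_eq_zero.1 ?_))
    refine (iInf₂_le (fun _ => E) (subset_iUnion (fun _ : ℕ => E) 0)).trans ?_
    simp [hE0]
  have h1 : packingMeasure (s₀ : ℝ) A < 1 := hs₀ ▸ zero_lt_one
  simp only [packingMeasure, iInf_lt_iff] at h1
  obtain ⟨C, hAC, hsum⟩ := h1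
  have hC0 : ∀ i, μ (C i) = 0 := fun i => by
    by_contra hne
    exact ENNReal.ne_top_of_tsum_ne_top (hsum.trans ENNReal.one_lt_top).ne i
      (packingPremeasure_eq_top_of_frequently_lt_card μ hpos hhalf hK hmass hs hfreq hne)
  have hA0 : μ A = 0 := measure_mono_null hAC (measure_iUnion_null hC0)
  have huniv : μ univ ≤ μ A + μ Aᶜ := by
    rw [← union_compl_self A]; exact measure_union_le _ _
  simp [hA0, hA] at huniv

end Equidistributed

/-! ## Mixed radix expansions -/

section MixedRadix

/-- The integer with the `k` leading digits `d 0, …, d (k - 1)` in the mixed radix system with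
bases `n`. -/
def mixedValue (n d : ℕ → ℕ) : ℕ → ℕ
  | 0 => 0
  | k + 1 => n k * mixedValue n d k + d k

/-- The product of the first `k` bases. -/
def radixProd (n : ℕ → ℕ) (k : ℕ) : ℕ := ∏ h ∈ Finset.range k, n h

variable {n d e : ℕ → ℕ}

theorem radixProd_succ (k : ℕ) : radixProd n (k + 1) = radixProd n k * n k :=
  Finset.prod_range_succ _ _

theorem radixProd_pos (hn : ∀ k, 2 ≤ n k) (k : ℕ) : 0 < radixProd n k :=
  Finset.prod_pos fun h _ => by have := hn h; omega

theorem mixedValue_lt_radixProd (hd : ∀ i, d i < n i) (k : ℕ) :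
    mixedValue n d k < radixProd n k := by
  induction k with
  | zero => simp [mixedValue, radixProd]
  | succ k ih =>
    rw [radixProd_succ, mixedValue]
    nlinarith [hd k]

theorem mixedValue_eq_iff {k : ℕ} (hd : ∀ i, d i < n i) (he : ∀ i, e i < n i) :
    mixedValue n d k = mixedValue n e k ↔ ∀ i < k, d i = e i := by
  induction k with
  | zero => simp [mixedValue]
  | succ k ih =>
    rw [Nat.forall_lt_succ_right, ← ih]
    simp only [mixedValue]
    refine ⟨fun h => ?_, fun h => by rw [h.1, h.2]⟩
    have h1 : d k = e k := by
      have := congrArg (· % n k) h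
      simpa [Nat.mul_add_mod, Nat.mod_eq_of_lt (hd k), Nat.mod_eq_of_lt (he k)] using this
    have hpos : 0 < n k := (Nat.zero_le _).trans_lt (hd k)
    exact ⟨Nat.eq_of_mul_eq_mul_left hpos (by omega), h1⟩

theorem sum_digits_eq_mixedValue_div (hn : ∀ k, 2 ≤ n k) (k : ℕ) :
    ∑ i ∈ Finset.range k, (∏ h ∈ Finset.range (i + 1), (n h : ℝ))⁻¹ * (d i : ℝ) =
      mixedValue n d k / radixProd n k := by
  induction k with
  | zero => simp [mixedValue]
  | succ k ih =>
    have h1 : (∏ h ∈ Finset.range (k + 1), (n h : ℝ)) = radixProd n k * n k := by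
      rw [← Nat.cast_mul, ← radixProd_succ, radixProd]; push_cast; rfl
    have h2 : (0 : ℝ) < radixProd n k := by exact_mod_cast radixProd_pos hn k
    have h3 : (0 : ℝ) < n k := by have := hn k; positivity
    rw [Finset.sum_range_succ, ih, h1, radixProd_succ, mixedValue]
    push_cast
    field_simp

theorem mixedValue_div_succ (hn : ∀ k, 2 ≤ n k) (k : ℕ) :
    (mixedValue n d (k + 1) / radixProd n (k + 1) : ℝ) =
      mixedValue n d k / radixProd n k + d k / (radixProd n k * n k) := by
  have h2 : (0 : ℝ) < radixProd n k := by exact_mod_cast radixProd_pos hn k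
  have h3 : (0 : ℝ) < n k := by have := hn k; positivity
  rw [radixProd_succ, mixedValue]
  push_cast
  field_simp

theorem mixedValue_div_mono (hn : ∀ k, 2 ≤ n k) :
    Monotone fun k => (mixedValue n d k / radixProd n k : ℝ) := by
  refine monotone_nat_of_le_succ fun k => ?_
  rw [mixedValue_div_succ hn]
  have : (0 : ℝ) ≤ d k / (radixProd n k * n k) := by positivity
  linarith

theorem mixedValue_add_one_div_anti (hn : ∀ k, 2 ≤ n k) (hd : ∀ k, d k < n k) :
    Antitone fun k => ((mixedValue n d k + 1) / radixProd n k : ℝ) := by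
  refine antitone_nat_of_succ_le fun k => ?_
  have h2 : (0 : ℝ) < radixProd n k := by exact_mod_cast radixProd_pos hn k
  have h3 : (0 : ℝ) < n k := by have := hn k; positivity
  have h4 : (d k : ℝ) + 1 ≤ n k := by exact_mod_cast hd k
  rw [radixProd_succ, mixedValue]
  push_cast
  rw [div_le_div_iff₀ (by positivity) h2]
  have h5 : 0 ≤ (n k - 1 - d k : ℝ) * radixProd n k := mul_nonneg (by linarith) h2.le
  nlinarith

/-- The partial sums are the left endpoints of nested intervals of length `1 / radixProd n k`. Left
endpoints increase and right endpoints decrease, so each partial sum lies below every right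
endpoint. -/
theorem tsum_digits_mem (hn : ∀ k, 2 ≤ n k) (hd : ∀ k, d k < n k) (k : ℕ) :
    (radixProd n k * ∑' i, (∏ h ∈ Finset.range (i + 1), (n h : ℝ))⁻¹ * (d i : ℝ) : ℝ) ∈
      Icc (mixedValue n d k : ℝ) (mixedValue n d k + 1) := by
  have hR : ∀ k, (0 : ℝ) < radixProd n k := fun k => by exact_mod_cast radixProd_pos hn k
  have hnn : ∀ i, (0 : ℝ) ≤ (∏ h ∈ Finset.range (i + 1), (n h : ℝ))⁻¹ * (d i : ℝ) := fun i => by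
    positivity
  have hle : ∀ j, ∑ i ∈ Finset.range j, (∏ h ∈ Finset.range (i + 1), (n h : ℝ))⁻¹ * (d i : ℝ) ≤
      (mixedValue n d k + 1) / radixProd n k := fun j => by
    rw [sum_digits_eq_mixedValue_div hn]
    refine (mixedValue_div_mono hn (le_max_left j k)).trans ?_
    refine le_trans ?_ (mixedValue_add_one_div_anti hn hd (le_max_right j k))
    have := hR (max j k)
    beta_reduce
    gcongr
    linarith
  constructor
  · rw [← div_le_iff₀' (hR k), ← sum_digits_eq_mixedValue_div hn]
    exact (summable_of_sum_range_le hnn hle).sum_le_tsum _ fun i _ => hnn i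
  · rw [← le_div_iff₀' (hR k)]
    exact Real.tsum_le_of_sum_range_le hnn hle

/-- A truncated expansion with remainder in `[0, 1]` determines all its leading digits up to
an error of one unit. -/
theorem mul_mem_Icc_mixedValue (hn : ∀ k, 2 ≤ n k) (hd : ∀ k, d k < n k) {l k : ℕ} (hlk : l ≤ k)
    {x y : ℝ} (hy : y ∈ Icc (0 : ℝ) 1) (hx : x = (mixedValue n d k + y) / radixProd n k) :
    (radixProd n l * x : ℝ) ∈ Icc (mixedValue n d l : ℝ) (mixedValue n d l + 1) := by
  have hl : (0 : ℝ) < radixProd n l := by exact_mod_cast radixProd_pos hn l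
  have hk : (0 : ℝ) < radixProd n k := by exact_mod_cast radixProd_pos hn k
  constructor
  · rw [← div_le_iff₀' hl]
    refine (mixedValue_div_mono hn hlk).trans ?_
    rw [hx]
    beta_reduce
    gcongr
    linarith [hy.1]
  · rw [← le_div_iff₀' hl]
    refine le_trans ?_ (mixedValue_add_one_div_anti hn hd hlk)
    rw [hx]
    beta_reduce
    gcongr
    exact hy.2

end MixedRadix

/-! ## Geometry of the construction -/

namespace MoranConstruction

variable (M : MoranConstruction)

instance instNonemptyDigit (k : ℕ) : Nonempty {w : ℕ × ℕ // w ∈ M.D k} := by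
  have h := M.two_le_card k
  obtain ⟨w, hw⟩ := Finset.card_pos.1 (by omega : 0 < (M.D k).card)
  exact ⟨⟨w, hw⟩⟩

variable {M}

/-- Finite words are written as truncations of infinite ones, so that `mixedValue` receives digits
at all levels; `exists_infWord_extending` makes this no restriction. -/
theorem wordMap_apply (w : M.InfWord) (k : ℕ) (y : Plane) :
    M.wordMap k (fun i => w i) y =
      !₂[(mixedValue M.n (fun h => (w h).1.1) k + y 0) / radixProd M.n k,
        (mixedValue M.m (fun h => (w h).1.2) k + y 1) / radixProd M.m k] := by
  induction k generalizing y with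
  | zero => ext i; fin_cases i <;> simp [wordMap, mixedValue, radixProd]
  | succ k ih =>
    have h1 : (0 : ℝ) < M.n k := by have := M.two_le_n k; positivity
    have h2 : (0 : ℝ) < M.m k := by have := M.two_le_m k; positivity
    have h3 : (0 : ℝ) < radixProd M.n k := by exact_mod_cast radixProd_pos M.two_le_n k
    have h4 : (0 : ℝ) < radixProd M.m k := by exact_mod_cast radixProd_pos M.two_le_m k
    change M.wordMap k (fun i => w i) (M.digitMap k (w k) y) = _
    rw [ih]
    ext i
    fin_cases i
    · simp [digitMap, mixedValue, radixProd_succ]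
      field_simp
      ring
    · simp [digitMap, mixedValue, radixProd_succ]
      field_simp
      ring

theorem exists_infWord_extending {k : ℕ} (w : M.Word k) :
    ∃ v : M.InfWord, w = fun i : Fin k => v i := by
  refine ⟨fun h => if hh : h < k then w ⟨h, hh⟩ else Classical.arbitrary _, ?_⟩
  funext i
  simp

theorem continuous_wordMap {k : ℕ} (w : M.Word k) : Continuous (M.wordMap k w) := by
  obtain ⟨v, rfl⟩ := exists_infWord_extending w
  have : M.wordMap k (fun i => v i) = _ := funext fun y => wordMap_apply v k y
  rw [this]
  refine (PiLp.continuous_toLp 2 _).comp (continuous_pi fun i => ?_)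
  fin_cases i
  · simp only [Fin.zero_eta, Matrix.cons_val_zero]; fun_prop
  · simp only [Fin.mk_one, Matrix.cons_val_one]; fun_prop

theorem isCompact_unitSquare : IsCompact unitSquare := by
  have h : unitSquare = (EuclideanSpace.equiv (Fin 2) ℝ).toHomeomorph ⁻¹'
      (Set.univ.pi fun _ => Icc (0 : ℝ) 1) := by
    ext x; simp only [unitSquare, mem_ofPred_eq, mem_preimage, Set.mem_pi, mem_univ,
      true_imp_iff]
    rfl
  rw [h, Homeomorph.isCompact_preimage]
  exact isCompact_univ_pi fun _ => isCompact_Icc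

theorem measurableSet_moranSet : MeasurableSet M.moranSet := by
  refine MeasurableSet.iInter fun k => MeasurableSet.iInter fun _ =>
    MeasurableSet.iUnion fun w => ?_
  exact (isCompact_unitSquare.image (continuous_wordMap w)).isClosed.measurableSet

variable (M) in
/-- The closed grid rectangle with sides `(n_1 ⋯ n_l)⁻¹` and `(m_1 ⋯ m_k)⁻¹` and position `q`. -/
def gridRect (l k : ℕ) (q : ℕ × ℕ) : Set Plane :=
  {x | (radixProd M.n l * x 0 : ℝ) ∈ Icc (q.1 : ℝ) (q.1 + 1) ∧
    (radixProd M.m k * x 1 : ℝ) ∈ Icc (q.2 : ℝ) (q.2 + 1)}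

variable (M) in
/-- The position of the grid rectangle addressed by the first `l` horizontal and the first `k`
vertical digits of `w`. -/
def gridIndex (l k : ℕ) (w : M.InfWord) : ℕ × ℕ :=
  (mixedValue M.n (fun h => (w h).1.1) l, mixedValue M.m (fun h => (w h).1.2) k)

theorem fst_digit_lt (w : M.InfWord) (h : ℕ) : (w h).1.1 < M.n h :=
  (M.digit_lt h _ (w h).2).1

theorem snd_digit_lt (w : M.InfWord) (h : ℕ) : (w h).1.2 < M.m h :=
  (M.digit_lt h _ (w h).2).2

theorem coding_mem_gridRect (w : M.InfWord) (l k : ℕ) :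
    M.coding w ∈ M.gridRect l k (M.gridIndex l k w) :=
  ⟨tsum_digits_mem M.two_le_n (fst_digit_lt w) l, tsum_digits_mem M.two_le_m (snd_digit_lt w) k⟩

theorem coding_mem_moranSet (w : M.InfWord) : M.coding w ∈ M.moranSet := by
  refine mem_iInter₂.2 fun k _ => mem_iUnion.2 ⟨fun i => w i, ?_⟩
  have h := coding_mem_gridRect w k k
  have h3 : (0 : ℝ) < radixProd M.n k := by exact_mod_cast radixProd_pos M.two_le_n k
  have h4 : (0 : ℝ) < radixProd M.m k := by exact_mod_cast radixProd_pos M.two_le_m k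
  refine ⟨!₂[radixProd M.n k * M.coding w 0 - (M.gridIndex k k w).1,
    radixProd M.m k * M.coding w 1 - (M.gridIndex k k w).2], ?_, ?_⟩
  · intro i
    fin_cases i
    · exact ⟨sub_nonneg.2 h.1.1, by simpa using by linarith [h.1.2]⟩
    · exact ⟨sub_nonneg.2 h.2.1, by simpa using by linarith [h.2.2]⟩
  · rw [wordMap_apply]
    ext i
    fin_cases i
    · simp [gridIndex, h3.ne']
    · simp [gridIndex, h4.ne']

/-- Level `k` of the intersection already fixes `k` digits in both directions, and forgetting the
horizontal ones beyond `l` enlarges the rectangle. No infinite code of `x` has to be produced. -/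
theorem moranSet_subset_gridRect {l k : ℕ} (hlk : l ≤ k) (hk : 1 ≤ k) {x : Plane}
    (hx : x ∈ M.moranSet) : ∃ w, x ∈ M.gridRect l k (M.gridIndex l k w) := by
  obtain ⟨w, y, hy, rfl⟩ := mem_iUnion.1 (mem_iInter₂.1 hx k hk)
  obtain ⟨v, rfl⟩ := exists_infWord_extending w
  refine ⟨v, ?_, ?_⟩
  · refine mul_mem_Icc_mixedValue M.two_le_n (fst_digit_lt v) hlk (hy 0) ?_
    rw [wordMap_apply]; rfl
  · refine mul_mem_Icc_mixedValue M.two_le_m (snd_digit_lt v) le_rfl (hy 1) ?_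
    rw [wordMap_apply]; rfl

instance instIsProbabilityMeasureMoranMeasure (p : M.ProbSeq) :
    IsProbabilityMeasure (M.moranMeasure p) := by
  unfold moranMeasure codeMeasure
  exact Measure.isProbabilityMeasure_map M.measurable_coding.aemeasurable

theorem moranMeasure_compl_moranSet (p : M.ProbSeq) : M.moranMeasure p M.moranSetᶜ = 0 := by
  rw [moranMeasure, Measure.map_apply M.measurable_coding measurableSet_moranSet.compl]
  convert measure_empty (μ := M.codeMeasure p)
  exact eq_empty_of_forall_notMem fun w hw => hw (coding_mem_moranSet w)

theorem dist_le_of_mem_gridRect {l k : ℕ} {q : ℕ × ℕ} {x y : Plane}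
    (hx : x ∈ M.gridRect l k q) (hy : y ∈ M.gridRect l k q) :
    dist x y ≤ (radixProd M.n l : ℝ)⁻¹ + (radixProd M.m k : ℝ)⁻¹ := by
  have h3 : (0 : ℝ) < radixProd M.n l := by exact_mod_cast radixProd_pos M.two_le_n l
  have h4 : (0 : ℝ) < radixProd M.m k := by exact_mod_cast radixProd_pos M.two_le_m k
  have key : ∀ {R a b c : ℝ}, 0 < R → R * a ∈ Icc c (c + 1) → R * b ∈ Icc c (c + 1) →
      |a - b| ≤ R⁻¹ := by
    intro R a b c hR ha hb
    rw [← one_div, le_div_iff₀' hR]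
    nth_rewrite 1 [← abs_of_pos hR]
    rw [← abs_mul, mul_sub, abs_le]
    constructor <;> linarith [ha.1, ha.2, hb.1, hb.2]
  have h0 := key h3 hx.1 hy.1
  have h1 := key h4 hx.2 hy.2
  rw [EuclideanSpace.dist_eq, Fin.sum_univ_two]
  refine Real.sqrt_le_iff.2 ⟨by positivity, ?_⟩
  rw [Real.dist_eq, Real.dist_eq]
  have := abs_nonneg (x 0 - y 0)
  have := abs_nonneg (x 1 - y 1)
  nlinarith [mul_pos (inv_pos.2 h3) (inv_pos.2 h4)]

end MoranConstruction

namespace MoranConstruction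

variable {M : MoranConstruction}

/-! ## The uniform measure on approximate squares -/

/-- The part of the digit `w` of level `h` that is recorded by a grid rectangle with `l` horizontal
digits: the whole digit if `h < l`, and its row otherwise. -/
def truncDigit (l h : ℕ) (w : ℕ × ℕ) : ℕ × ℕ := if h < l then w else (0, w.2)

variable (M) in
/-- The sequence of uniform probability vectors. -/
def uniformSeq : M.ProbSeq := fun _ => PMF.uniformOfFintype _

/-- This turns equality of addresses into independent conditions, one per level, so that the set of
words with a given address is a product set. -/
theorem gridIndex_eq_iff {l k : ℕ} (hlk : l ≤ k) (v w : M.InfWord) :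
    M.gridIndex l k v = M.gridIndex l k w ↔
      ∀ h < k, truncDigit l h (v h).1 = truncDigit l h (w h).1 := by
  rw [gridIndex, gridIndex, Prod.mk_inj, mixedValue_eq_iff (fst_digit_lt v) (fst_digit_lt w),
    mixedValue_eq_iff (snd_digit_lt v) (snd_digit_lt w)]
  refine ⟨fun ⟨h1, h2⟩ h hk => ?_, fun hh => ⟨fun h hl => ?_, fun h hk => ?_⟩⟩
  · unfold truncDigit
    split_ifs with hl
    · exact Prod.ext (h1 h hl) (h2 h hk)
    · rw [h2 h hk]
  · have := hh h (hl.trans_le hlk)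
    rw [truncDigit, truncDigit, if_pos hl, if_pos hl] at this
    rw [this]
  · have := hh h hk
    unfold truncDigit at this
    split_ifs at this
    · rw [this]
    · exact (Prod.mk.inj this).2

/-- Here the equal-row hypothesis enters: a level recorded only by its row leaves `c` choices,
whichever row it is. -/
theorem card_filter_truncDigit_eq {l h c : ℕ}
    (hrow : ∀ j, M.rowCount h j ≠ 0 → M.rowCount h j = c) {w : ℕ × ℕ} (hw : w ∈ M.D h) :
    ((M.D h).filter fun v => truncDigit l h v = truncDigit l h w).card = if h < l then 1 else c := by
  by_cases hl : h < l
  · simp only [truncDigit, if_pos hl, Finset.filter_eq', if_pos hw, Finset.card_singleton]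
  · rw [if_neg hl]
    have hset : (((M.D h).filter fun v => truncDigit l h v = truncDigit l h w : Finset (ℕ × ℕ)) :
        Set (ℕ × ℕ)) = (fun i => (i, w.2)) '' {i | (i, w.2) ∈ M.D h} := by
      ext ⟨a, b⟩
      simp only [truncDigit, if_neg hl, Finset.coe_filter, Prod.mk.injEq, true_and, mem_image,
        mem_ofPred_eq]
      constructor
      · rintro ⟨h1, rfl⟩
        exact ⟨a, h1, rfl, rfl⟩
      · rintro ⟨i, h1, rfl, rfl⟩
        exact ⟨h1, rfl⟩
    have hcard : ((M.D h).filter fun v => truncDigit l h v = truncDigit l h w).card =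
        M.rowCount h w.2 := by
      rw [← Set.ncard_coe_finset, hset, Set.ncard_image_of_injective _ fun a b hab =>
        (Prod.mk.inj hab).1]
      rfl
    rw [hcard]
    refine hrow _ ?_
    rw [← hcard]
    have hmem : w ∈ (M.D h).filter fun v => truncDigit l h v = truncDigit l h w :=
      Finset.mem_filter.2 ⟨hw, rfl⟩
    exact (Finset.card_pos.2 ⟨w, hmem⟩).ne'

theorem uniformSeq_truncDigit_fiber {l h c : ℕ}
    (hrow : ∀ j, M.rowCount h j ≠ 0 → M.rowCount h j = c) (w : {w : ℕ × ℕ // w ∈ M.D h}) :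
    (M.uniformSeq h).toMeasure {v | truncDigit l h v.1 = truncDigit l h w.1} =
      ((if h < l then 1 else c : ℕ) : ℝ≥0∞) / (M.D h).card := by
  classical
  rw [uniformSeq, PMF.toMeasure_uniformOfFintype_apply _ (Set.to_countable _).measurableSet,
    Fintype.card_coe, ← card_filter_truncDigit_eq hrow w.2]
  congr 2
  rw [← Set.toFinset_card, ← Finset.card_map (Function.Embedding.subtype _)]
  congr 1
  ext v
  simp
  tauto

/-- The mass of each approximate square under the uniform measure. -/
theorem codeMeasure_gridIndex_fiber {c : ℕ → ℕ}
    (hrow : ∀ k j, M.rowCount k j ≠ 0 → M.rowCount k j = c k) {l k : ℕ} (hlk : l ≤ k)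
    (w : M.InfWord) :
    MeasurableSet {v | M.gridIndex l k v = M.gridIndex l k w} ∧
      M.codeMeasure M.uniformSeq {v | M.gridIndex l k v = M.gridIndex l k w} =
        ∏ h ∈ Finset.range k, ((if h < l then 1 else c h : ℕ) : ℝ≥0∞) / (M.D h).card := by
  have hset : {v | M.gridIndex l k v = M.gridIndex l k w} =
      (Finset.range k : Set ℕ).pi fun h =>
        {v : {w : ℕ × ℕ // w ∈ M.D h} | truncDigit l h v.1 = truncDigit l h (w h).1} := by
    ext v
    simp [gridIndex_eq_iff hlk, Set.mem_pi]
  rw [hset]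
  refine ⟨MeasurableSet.pi (Finset.countable_toSet _) fun h _ =>
    (Set.to_countable _).measurableSet, ?_⟩
  rw [codeMeasure, Measure.infinitePi_pi _ fun h _ => (Set.to_countable _).measurableSet]
  exact Finset.prod_congr rfl fun h _ => uniformSeq_truncDigit_fiber (hrow h) (w h)

theorem finite_range_gridIndex (l k : ℕ) : (Set.range (M.gridIndex l k)).Finite := by
  refine ((Set.finite_Iio (radixProd M.n l)).prod (Set.finite_Iio (radixProd M.m k))).subset ?_
  rintro _ ⟨w, rfl⟩
  exact ⟨mixedValue_lt_radixProd (fst_digit_lt w) l, mixedValue_lt_radixProd (snd_digit_lt w) k⟩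

variable (M) in
/-- The positions of the grid rectangles that are addressed by infinite words. -/
def gridIndices (l k : ℕ) : Finset (ℕ × ℕ) := (finite_range_gridIndex (M := M) l k).toFinset

/-- The addresses partition the word space into pieces of equal mass, so that mass is the reciprocal
of their number; neither factor has to be computed. -/
theorem codeMeasure_gridIndex_eq_le {c : ℕ → ℕ}
    (hrow : ∀ k j, M.rowCount k j ≠ 0 → M.rowCount k j = c k) {l k : ℕ} (hlk : l ≤ k)
    (q : ℕ × ℕ) :
    M.codeMeasure M.uniformSeq {v | M.gridIndex l k v = q} ≤
      ((M.gridIndices l k).card : ℝ≥0∞)⁻¹ := by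
  by_cases hq : q ∈ M.gridIndices l k
  · have hmem : ∀ q ∈ M.gridIndices l k, ∃ w, M.gridIndex l k w = q := fun q hq => by
      simpa [gridIndices] using hq
    set a := ∏ h ∈ Finset.range k, ((if h < l then 1 else c h : ℕ) : ℝ≥0∞) / (M.D h).card
    have hfib : ∀ q ∈ M.gridIndices l k, M.codeMeasure M.uniformSeq {v | M.gridIndex l k v = q} = a :=
      fun q hq => by
        obtain ⟨w, rfl⟩ := hmem q hq
        exact (codeMeasure_gridIndex_fiber hrow hlk w).2
    have hunion : ⋃ q ∈ M.gridIndices l k, {v | M.gridIndex l k v = q} = univ := by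
      ext v
      simp [gridIndices]
    have hsum : M.codeMeasure M.uniformSeq univ = (M.gridIndices l k).card * a := by
      rw [← hunion, measure_biUnion_finset, Finset.sum_congr rfl hfib, Finset.sum_const,
        nsmul_eq_mul]
      · intro q _ q' _ hne
        exact Set.disjoint_left.2 fun v hv hv' => hne (hv.symm.trans hv')
      · intro q hq
        obtain ⟨w, rfl⟩ := hmem q hq
        exact (codeMeasure_gridIndex_fiber hrow hlk w).1
    have hone : M.codeMeasure M.uniformSeq univ = 1 := by
      unfold codeMeasure
      exact measure_univ
    rw [hfib q hq]
    exact (ENNReal.eq_inv_of_mul_eq_one_left (by rw [mul_comm, ← hsum, hone])).le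
  · have : {v | M.gridIndex l k v = q} = ∅ := by
      refine eq_empty_of_forall_notMem fun v hv => hq ?_
      simpa [gridIndices] using ⟨v, hv⟩
    simp [this]

theorem moranMeasure_uniformSeq_closedBall_le {c : ℕ → ℕ}
    (hrow : ∀ k j, M.rowCount k j ≠ 0 → M.rowCount k j = c k) {l k : ℕ} (hlk : l ≤ k)
    (hle : radixProd M.n l ≤ radixProd M.m k) (x : Plane) :
    M.moranMeasure M.uniformSeq (Metric.closedBall x (radixProd M.m k : ℝ)⁻¹) ≤
      ENNReal.ofReal (16 / (M.gridIndices l k).card) := by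
  have h3 : (0 : ℝ) < radixProd M.n l := by exact_mod_cast radixProd_pos M.two_le_n l
  have h4 : (0 : ℝ) < radixProd M.m k := by exact_mod_cast radixProd_pos M.two_le_m k
  -- If `R * a ∈ [z, z + 1]` and `|R * a - R * b| ≤ 1`, then `R * b - 2 ≤ z ≤ R * b + 1`. Taking the
  -- floor of the upper end leaves four candidates for `z`.
  let window : ℝ → Finset ℕ := fun t => Finset.Icc (⌊t + 1⌋₊ - 3) ⌊t + 1⌋₊
  have hcard : ∀ t, (window t).card ≤ 4 := fun t => by
    simp only [window, Nat.card_Icc]; omega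
  have hwindow : ∀ {R a b : ℝ} {z : ℕ}, 0 < R → |a - b| ≤ R⁻¹ → R * a ∈ Icc (z : ℝ) (z + 1) →
      z ∈ window (R * b) := by
    intro R a b z hR hab hz
    have h1 : |R * a - R * b| ≤ 1 := by
      rw [← mul_sub, abs_mul, abs_of_pos hR]
      calc R * |a - b| ≤ R * R⁻¹ := by gcongr
        _ = 1 := mul_inv_cancel₀ hR.ne'
    rw [abs_le] at h1
    have h2 : z ≤ ⌊R * b + 1⌋₊ := Nat.le_floor (by linarith [hz.1, h1.2])
    have h5 : ⌊R * b + 1⌋₊ ≤ z + 3 := by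
      refine Nat.floor_le_of_le ?_
      push_cast
      linarith [hz.2, h1.1]
    simp only [window, Finset.mem_Icc]
    omega
  let G : Finset (ℕ × ℕ) :=
    window (radixProd M.n l * x 0) ×ˢ window (radixProd M.m k * x 1)
  have hG : G.card ≤ 16 := by
    rw [Finset.card_product]
    exact Nat.mul_le_mul (hcard _) (hcard _)
  have hsub : M.coding ⁻¹' Metric.closedBall x (radixProd M.m k : ℝ)⁻¹ ⊆
      ⋃ q ∈ G, {v | M.gridIndex l k v = q} := by
    intro v hv
    have hgrid := coding_mem_gridRect v l k
    have hdist : ∀ i, |M.coding v i - x i| ≤ (radixProd M.m k : ℝ)⁻¹ := fun i => by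
      have h := PiLp.norm_apply_le (M.coding v - x) i
      rw [← dist_eq_norm] at h
      exact (by simpa using h : |M.coding v i - x i| ≤ dist (M.coding v) x).trans hv
    refine mem_iUnion₂.2 ⟨_, Finset.mem_product.2 ⟨?_, ?_⟩, rfl⟩
    -- The horizontal cells are at least as wide as the radius, by `hle`.
    · refine hwindow h3 ((hdist 0).trans ?_) hgrid.1
      gcongr
    · exact hwindow h4 (hdist 1) hgrid.2
  have hne : 0 < ((M.gridIndices l k).card : ℝ) := by
    have : M.gridIndex l k (fun _ => Classical.arbitrary _) ∈ M.gridIndices l k := by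
      simp [gridIndices]
    exact_mod_cast Finset.card_pos.2 ⟨_, this⟩
  rw [moranMeasure, Measure.map_apply M.measurable_coding Metric.isClosed_closedBall.measurableSet]
  calc M.codeMeasure M.uniformSeq (M.coding ⁻¹' Metric.closedBall x (radixProd M.m k : ℝ)⁻¹)
      ≤ ∑ q ∈ G, M.codeMeasure M.uniformSeq {v | M.gridIndex l k v = q} :=
        (measure_mono hsub).trans (measure_biUnion_finset_le _ _)
    _ ≤ G.card • ((M.gridIndices l k).card : ℝ≥0∞)⁻¹ :=
        Finset.sum_le_card_nsmul _ _ _ fun q _ => codeMeasure_gridIndex_eq_le hrow hlk q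
    _ ≤ (16 : ℕ) * ((M.gridIndices l k).card : ℝ≥0∞)⁻¹ := by
        rw [nsmul_eq_mul]; gcongr
    _ = ENNReal.ofReal (16 / (M.gridIndices l k).card) := by
        rw [ENNReal.ofReal_div_of_pos hne, ENNReal.ofReal_natCast, div_eq_mul_inv]
        simp

/-! ## Comparable horizontal and vertical scales -/

/-- Take the largest admissible `l ≤ k`. If `l < k`, maximality loses at most one factor `n_l ≤ b`;
if `l = k`, the inequality `m ≤ n` gives the upper bound. -/
theorem exists_comparable_level (hnm : ∀ k, M.m k ≤ M.n k) {b : ℕ} (hb : ∀ k, M.n k ≤ b) (k : ℕ) :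
    ∃ l ≤ k, radixProd M.n l ≤ radixProd M.m k ∧ radixProd M.m k ≤ b * radixProd M.n l := by
  classical
  let l := Nat.findGreatest (fun l => radixProd M.n l ≤ radixProd M.m k) k
  have hlk : l ≤ k := Nat.findGreatest_le k
  refine ⟨l, hlk, Nat.findGreatest_spec (P := fun l => radixProd M.n l ≤ radixProd M.m k)
    (Nat.zero_le k) ?_, ?_⟩
  · exact radixProd_pos M.two_le_m k
  · rcases hlk.eq_or_lt with h | h
    · have h1 : radixProd M.m k ≤ radixProd M.n k := Finset.prod_le_prod' fun i _ => hnm i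
      have h2 := M.two_le_n 0
      rw [h]
      nlinarith [hb 0, Nat.zero_le (radixProd M.n k)]
    · have h1 := Nat.findGreatest_is_greatest (P := fun l => radixProd M.n l ≤ radixProd M.m k)
        (Nat.lt_succ_self l) h
      rw [radixProd_succ] at h1
      nlinarith [hb l, Nat.zero_le (radixProd M.n l)]

theorem dim_moranSet_le_dim_uniformSeq (hN : BddAbove (Set.range M.n ∪ Set.range M.m))
    (hnm : ∀ k, M.m k ≤ M.n k) (c : ℕ → ℕ)
    (hrow : ∀ k j, M.rowCount k j ≠ 0 → M.rowCount k j = c k) :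
    dimH M.moranSet ≤ measureDimH (M.moranMeasure M.uniformSeq) ∧
      dimP M.moranSet ≤ measureDimP (M.moranMeasure M.uniformSeq) := by
  obtain ⟨b, hb⟩ := hN
  have hbn : ∀ k, M.n k ≤ b := fun k => hb (Or.inl ⟨k, rfl⟩)
  have hbm : ∀ k, M.m k ≤ b := fun k => hb (Or.inr ⟨k, rfl⟩)
  have hb0 : (0 : ℝ) < b := by
    have := (M.two_le_n 0).trans (hbn 0)
    positivity
  have hR : ∀ k, (0 : ℝ) < radixProd M.m k := fun k => by
    exact_mod_cast radixProd_pos M.two_le_m k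
  choose l hlk hle hge using exists_comparable_level hnm hbn
  -- The shift to `k + 1` avoids level 0, which the intersection defining `moranSet` omits.
  let ρ : ℕ → ℝ := fun k => (radixProd M.m (k + 1) : ℝ)⁻¹
  have hpos : ∀ k, 0 < ρ k := fun k => inv_pos.2 (hR _)
  have hstep : ∀ k, ρ k = M.m (k + 1) * ρ (k + 1) := fun k => by
    have h1 : (0 : ℝ) < M.m (k + 1) := by have := M.two_le_m (k + 1); positivity
    have h2 := hR (k + 1)
    simp only [ρ]
    rw [radixProd_succ (k + 1)]
    push_cast
    field_simp
  have hhalf : ∀ k, 2 * ρ (k + 1) ≤ ρ k := fun k => by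
    have h1 : (2 : ℝ) ≤ M.m (k + 1) := by exact_mod_cast M.two_le_m (k + 1)
    rw [hstep k]
    exact mul_le_mul_of_nonneg_right h1 (hpos _).le
  have hB : ∀ k, ρ k ≤ b * ρ (k + 1) := fun k => by
    have h1 : (M.m (k + 1) : ℝ) ≤ b := by exact_mod_cast hbm (k + 1)
    rw [hstep k]
    exact mul_le_mul_of_nonneg_right h1 (hpos _).le
  -- One constant serves both purposes: diameters need `b + 1`, masses need 16.
  have hK : (0 : ℝ) < b + 16 := by positivity
  have hcover : ∀ k, M.moranSet ⊆ ⋃ q ∈ M.gridIndices (l (k + 1)) (k + 1),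
      M.gridRect (l (k + 1)) (k + 1) q := fun k x hx => by
    obtain ⟨w, hw⟩ := moranSet_subset_gridRect (hlk (k + 1)) (by omega) hx
    exact mem_iUnion₂.2 ⟨_, by simp [gridIndices], hw⟩
  have hdiam : ∀ k, ∀ q ∈ M.gridIndices (l (k + 1)) (k + 1),
      ∀ x ∈ M.gridRect (l (k + 1)) (k + 1) q, ∀ y ∈ M.gridRect (l (k + 1)) (k + 1) q,
        dist x y ≤ (b + 16) * ρ k := fun k q _ x hx y hy => by
    refine (dist_le_of_mem_gridRect hx hy).trans ?_
    have h3 : (0 : ℝ) < radixProd M.n (l (k + 1)) := by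
      exact_mod_cast radixProd_pos M.two_le_n _
    have h1 : (radixProd M.n (l (k + 1)) : ℝ)⁻¹ ≤ b * ρ k := by
      have h2 : (radixProd M.m (k + 1) : ℝ) ≤ b * radixProd M.n (l (k + 1)) := by
        exact_mod_cast hge (k + 1)
      simp only [ρ]
      rw [← div_eq_mul_inv, inv_eq_one_div, div_le_div_iff₀ h3 (hR _)]
      linarith
    have h2 := hpos k
    change _ + ρ k ≤ _
    linarith
  have hmass : ∀ k x, M.moranMeasure M.uniformSeq (Metric.closedBall x (ρ k)) ≤
      ENNReal.ofReal ((b + 16) / (M.gridIndices (l (k + 1)) (k + 1)).card) := fun k x => by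
    refine (moranMeasure_uniformSeq_closedBall_le hrow (hlk (k + 1)) (hle (k + 1)) x).trans
      (ENNReal.ofReal_le_ofReal (div_le_div_of_nonneg_right ?_ (Nat.cast_nonneg _)))
    linarith
  exact ⟨dimH_le_measureDimH_of_equidistributed _ hpos hhalf hB hK hb0 hcover hdiam hmass,
    dimP_le_measureDimP_of_equidistributed _ hpos hhalf hB hK hb0 hcover hdiam hmass⟩

end MoranConstruction

end

theorem corollary2p3 (M : MoranConstruction)
    (hN : BddAbove (Set.range M.n ∪ Set.range M.m))
    (hFSC : M.FrequencySeparation)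
    (hnm : ∀ k, M.m k ≤ M.n k)
    (c : ℕ → ℕ) (hrow : ∀ k j, M.rowCount k j ≠ 0 → M.rowCount k j = c k) :
    ∃ p : M.ProbSeq,
      (IsGreatest {d | ∃ p' : M.ProbSeq, d = measureDimH (M.moranMeasure p')}
          (measureDimH (M.moranMeasure p)) ∧
        measureDimH (M.moranMeasure p) = dimH M.moranSet) ∧
      (IsGreatest {d | ∃ p' : M.ProbSeq, d = measureDimP (M.moranMeasure p')}
          (measureDimP (M.moranMeasure p)) ∧
        measureDimP (M.moranMeasure p) = dimP M.moranSet) := by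
  have hH : ∀ p, measureDimH (M.moranMeasure p) ≤ dimH M.moranSet := fun p =>
    iInf₂_le M.moranSet (MoranConstruction.moranMeasure_compl_moranSet p)
  have hP : ∀ p, measureDimP (M.moranMeasure p) ≤ dimP M.moranSet := fun p =>
    iInf₂_le M.moranSet (MoranConstruction.moranMeasure_compl_moranSet p)
  obtain ⟨hH', hP'⟩ := MoranConstruction.dim_moranSet_le_dim_uniformSeq hN hnm c hrow
  refine ⟨M.uniformSeq, ⟨⟨⟨_, rfl⟩, ?_⟩, (hH _).antisymm hH'⟩,
    ⟨⟨⟨_, rfl⟩, ?_⟩, (hP _).antisymm hP'⟩⟩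
  · rintro _ ⟨p, rfl⟩
    exact (hH p).trans hH'
  · rintro _ ⟨p, rfl⟩
    exact (hP p).trans hP'
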